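/- Let $(X,Y)$ be a dual pair of real locally convex spaces with separating bilinear form $\langle\cdot,\cdot\rangle$, whose topologies are compatible with the pairing (the continuous dual of $X$ is $Y$ and that of $Y$ is $X$). Let $\Phi:X\to\mathbb{R}\cup\{+\infty\}$ be proper, convex and lower semicontinuous, $\bar x\in\operatorname{dom}\Phi=\{x\mid\Phi(x)<+\infty\}$ and $\lambda\in\mathbb{R}$. Write $[\Phi\le a]=\{x\in X\mid \Phi(x)\le a\}$; $S_\infty=\{v\in X\mid x+tv\in S\ \ \forall x\in S,\ t\ge 0\}$ for the asymptotic (recession) cone of a nonempty closed convex set $S\subset X$; $\mathrm{N}_S(\bar x)=\{x^*\in Y\mid\langle x^*,x-\bar x\rangle\le 0\ \ \forall x\in S\}$; $\partial_\varepsilon\Phi(\bar x)=\{x^*\in Y\mid \langle x^*,u-\bar x\rangle\le\Phi(u)-\Phi(\bar x)+\varepsilon\ \ \forall u\in X\}$ for $\varepsilon\ge0$ and $\partial_\varepsilon\Phi(\bar x)=\emptyset$ for $\varepsilon<0$; $\mathbb{R}_+A=\{ta\mid t\ge0,\ a\in A\}$; and $\operatorname{cl}$ for the closure in $Y$. (1)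 If $[\Phi\le\lambda]\ne\emptyset$ and $\Phi(\bar x)>\lambda$, then $$\mathrm{N}_{[\Phi\le\lambda]\cup(\bar x+[\Phi\le\Phi(\bar x)]_\infty)}(\bar x)=\operatorname{cl}\bigl(\mathbb{R}_+\,\partial_{\Phi(\bar x)-\lambda}\Phi(\bar x)\bigr).$$ (2) If $[\Phi\le\lambda]=\emptyset$, then $$\mathrm{N}_{\bar x+[\Phi\le\Phi(\bar x)]_\infty}(\bar x)=\limsup_{\substack{\mu(\lambda-\Phi(\bar x)+\varepsilon)\to0\\ \mu\ge0}}\mu\,\partial_\varepsilon\Phi(\bar x)=\operatorname{cl}\bigl(\mathbb{R}_+\,\partial_\varepsilon\Phi(\bar x)\bigr),$$ where the last equality holds for every real $\varepsilon\ge\Phi(\bar x)-\lambda$, and the $\limsup$ is the set of all $\xi\in Y$ such that for every neighbourhood $W$ of $\xi$ and every $\eta>0$ there are $\mu\ge0$ and $\varepsilon\in\mathbb{R}$ with $|\mu(\lambda-\Phi(\bar x)+\varepsilon)|<\eta$ and $\mu\,\partial_\varepsilon\Phi(\bar x)\cap W\neq\emptyset$. -/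

import Mathlib

open scoped Pointwise Topology

/-- A separating bilinear form `B : X × Y → ℝ`, with topologies on `X` and `Y` compatible with it:
the continuous linear functionals on `X` are exactly the functionals `x ↦ B x y` with `y : Y`, and
the continuous linear functionals on `Y` are exactly the functionals `y ↦ B x y` with `x : X`. -/
structure IsCompatibleDualPair {X Y : Type*}
    [AddCommGroup X] [Module ℝ X] [TopologicalSpace X]
    [AddCommGroup Y] [Module ℝ Y] [TopologicalSpace Y]
    (B : X →ₗ[ℝ] Y →ₗ[ℝ] ℝ) : Prop where
  separatingLeft : B.SeparatingLeft
  separatingRight : B.SeparatingRight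
  continuous_iff_left : ∀ f : X →ₗ[ℝ] ℝ, Continuous f ↔ ∃ y : Y, ∀ x : X, f x = B x y
  continuous_iff_right : ∀ g : Y →ₗ[ℝ] ℝ, Continuous g ↔ ∃ x : X, ∀ y : Y, g y = B x y

/-- The effective domain `dom Φ`. -/
def effectiveDomain {X : Type*} (Φ : X → EReal) : Set X := {x | Φ x < ⊤}

/-- The class `Γ₀(X)` of proper, convex, lower semicontinuous functions `Φ : X → ℝ ∪ {+∞}`.
Convexity is convexity of the epigraph. -/
structure IsGammaZero {X : Type*} [AddCommGroup X] [Module ℝ X] [TopologicalSpace X]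
    (Φ : X → EReal) : Prop where
  ne_bot : ∀ x, Φ x ≠ ⊥
  proper : (effectiveDomain Φ).Nonempty
  convex : Convex ℝ {p : X × ℝ | Φ p.1 ≤ (p.2 : EReal)}
  lsc : LowerSemicontinuous Φ

/-- The sublevel set `[Φ ≤ a]`. -/
def sublevelSet {X : Type*} (Φ : X → EReal) (a : EReal) : Set X := {x | Φ x ≤ a}

/-- The asymptotic (recession) cone `S_∞` of a nonempty closed convex set `S`: the directions `v`
with `x + t v ∈ S` for all `x ∈ S` and `t ≥ 0`. Its indicator function is the asymptotic function
`v ↦ sup_{t > 0} t⁻¹ (I_S (x + t v) - I_S x)`, `x ∈ S`, of the indicator function `I_S` of `S`. -/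
def asymptoticConeOf {X : Type*} [AddCommGroup X] [Module ℝ X] (S : Set X) : Set X :=
  {v | ∀ x ∈ S, ∀ t : ℝ, 0 ≤ t → x + t • v ∈ S}

/-- The normal cone `N_S(x̄) = {y ∈ Y | ⟨y, x - x̄⟩ ≤ 0 for all x ∈ S}`. -/
def normalCone {X Y : Type*} [AddCommGroup X] [Module ℝ X] [AddCommGroup Y] [Module ℝ Y]
    (B : X →ₗ[ℝ] Y →ₗ[ℝ] ℝ) (S : Set X) (xbar : X) : Set Y :=
  {y | ∀ x ∈ S, B (x - xbar) y ≤ 0}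

/-- The `ε`-subdifferential `∂_ε Φ(x)`; it is empty if `ε < 0` or `x ∉ dom Φ`. -/
def epsSubdifferential {X Y : Type*}
    [AddCommGroup X] [Module ℝ X] [AddCommGroup Y] [Module ℝ Y]
    (B : X →ₗ[ℝ] Y →ₗ[ℝ] ℝ) (Φ : X → EReal) (ε : ℝ) (x : X) : Set Y :=
  {y | 0 ≤ ε ∧ x ∈ effectiveDomain Φ ∧
    ∀ u : X, ((B (u - x) y : ℝ) : EReal) ≤ Φ u - Φ x + (ε : EReal)}

/-- The Painlevé–Kuratowski upper limit of the sets `M u` along the filter `l`: the points `v` such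
that for every neighbourhood `W` of `v` and every `Z ∈ l` some `u ∈ Z` has `M u ∩ W ≠ ∅`. -/
def kuratowskiLimsup {U V : Type*} [TopologicalSpace V] (l : Filter U) (M : U → Set V) : Set V :=
  {v | ∀ W ∈ 𝓝 v, ∀ Z ∈ l, ∃ u ∈ Z, (M u ∩ W).Nonempty}

/-! Polarity reduces the claim to one inclusion: if `y` is normal at `x̄` and `v : X` is nonpositive
on `∂_ε Φ(x̄)`, then `⟨v, y⟩ ≤ 0`. Look at the ray in the horizontal direction `(v, 0)` from the
point `(x̄, Φ(x̄) - ε)` strictly below the epigraph of `Φ`. If the ray meets the epigraph, then `v`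
points into `[Φ ≤ Φ(x̄) - ε]`; if `(v, 0)` is an asymptotic direction of the epigraph, then `v` is
one of `[Φ ≤ Φ(x̄)]`. Otherwise `(v, 0)` lies outside the closed cone generated by the epigraph seen
from that point, and a separating functional, tilted so as not to be vertical, is up to scaling an
`ε`-subgradient that is positive at `v`. -/

section Cones

variable {E : Type*} [AddCommGroup E] [Module ℝ E] [TopologicalSpace E] [IsTopologicalAddGroup E]
  [ContinuousSMul ℝ E]

theorem mem_asymptoticCone_of_mem_closure_of_ray_disjoint {C : Set E} (hC : IsClosed C) {p v : E}
    (hv : v ∈ closure {w | ∃ t : ℝ, 0 ≤ t ∧ p + t • w ∈ C})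
    (hray : ∀ t : ℝ, 0 ≤ t → p + t • v ∉ C) : v ∈ asymptoticCone ℝ C := by
  by_contra hasym
  obtain ⟨M, hM⟩ : ∃ M : ℝ, ∀ᶠ w in 𝓝 v, ∀ t ≥ M, p + t • w ∉ C := by
    rw [mem_asymptoticCone_iff, Filter.not_frequently,
      AffineSpace.asymptoticNhds_eq_smul_vadd v p, Filter.vadd_pure, Filter.eventually_map,
      ← Filter.map₂_smul, ← Filter.map_prod_eq_map₂, Filter.eventually_map] at hasym
    obtain ⟨P, hP, Q, hQ, h⟩ := Filter.eventually_prod_iff.1 hasym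
    obtain ⟨M, hM⟩ := Filter.eventually_atTop.1 hP
    exact ⟨M, hQ.mono fun w hw t ht => by simpa [add_comm] using h (hM t ht) hw⟩
  have hbounded : ∀ᶠ w in 𝓝 v, ∀ t ∈ Set.Icc 0 M, p + t • w ∉ C :=
    isCompact_Icc.eventually_forall_of_forall_eventually fun t ht =>
      (hC.isOpen_compl.preimage (by fun_prop : Continuous fun z : E × ℝ => p + z.2 • z.1)).mem_nhds
        (hray t ht.1)
  obtain ⟨w, ⟨t, ht, hmem⟩, hfar, hnear⟩ :=
    ((mem_closure_iff_frequently.1 hv).and_eventually (hM.and hbounded)).exists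
  exact (le_total M t).elim (fun h => hfar t h hmem) (fun h => hnear t ⟨ht, h⟩ hmem)

variable [LocallyConvexSpace ℝ E]

theorem exists_strongDual_nonpos_pos_of_notMem_closure_hull {A : Set E} (hA : A.Nonempty) {x : E}
    (hx : x ∉ closure (ConvexCone.hull ℝ A : Set E)) :
    ∃ f : StrongDual ℝ E, (∀ a ∈ A, f a ≤ 0) ∧ 0 < f x := by
  obtain ⟨K, hK⟩ : ∃ K : ProperCone ℝ E, (K : ConvexCone ℝ E) = (ConvexCone.hull ℝ A).closure :=
    CanLift.prf _ ⟨(hA.mono ConvexCone.subset_hull).closure, isClosed_closure⟩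
  have hmem : ∀ z, z ∈ K ↔ z ∈ closure (ConvexCone.hull ℝ A : Set E) := fun z => by
    rw [← ConvexCone.coe_closure, ← hK]; rfl
  obtain ⟨f, hf, hfx⟩ := K.hyperplane_separation_point (mt (hmem x).1 hx)
  refine ⟨-f, fun a ha => ?_, by simpa using hfx⟩
  simpa using hf a ((hmem a).2 (subset_closure (ConvexCone.subset_hull ha)))

theorem mem_closure_Ici_smul_of_forall_strongDual {A : Set E} (hconv : Convex ℝ A)
    (hA : A.Nonempty) {x : E}
    (hx : ∀ f : StrongDual ℝ E, (∀ a ∈ A, f a ≤ 0) → f x ≤ 0) :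
    x ∈ closure (Set.Ici (0 : ℝ) • A) := by
  have hsub : (ConvexCone.hull ℝ A : Set E) ⊆ Set.Ici (0 : ℝ) • A := fun z hz => by
    obtain ⟨r, hr, a, ha, rfl⟩ := (ConvexCone.mem_hull_of_convex hconv).1 hz
    exact Set.smul_mem_smul hr.le ha
  by_contra hcl
  obtain ⟨f, hf, hfx⟩ :=
    exists_strongDual_nonpos_pos_of_notMem_closure_hull hA fun h => hcl (closure_mono hsub h)
  exact (hx f hf).not_gt hfx

theorem exists_strongDual_le_apply_and_pos_of_ray_disjoint {C : Set E} (hconv : Convex ℝ C)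
    (hC : IsClosed C) (hne : C.Nonempty) {p v : E} (hray : ∀ t : ℝ, 0 ≤ t → p + t • v ∉ C)
    (hasym : v ∉ asymptoticCone ℝ C) :
    ∃ f : StrongDual ℝ E, (∀ q ∈ C, f q ≤ f p) ∧ 0 < f v := by
  have hsub : (ConvexCone.hull ℝ ((p + ·) ⁻¹' C) : Set E) ⊆
      {w | ∃ t : ℝ, 0 ≤ t ∧ p + t • w ∈ C} := fun w hw => by
    obtain ⟨r, hr, q, hq, rfl⟩ :=
      (ConvexCone.mem_hull_of_convex (hconv.translate_preimage_right p)).1 hw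
    exact ⟨r⁻¹, (inv_pos.2 hr).le, by simpa [inv_smul_smul₀ hr.ne'] using hq⟩
  obtain ⟨f, hf, hfv⟩ := exists_strongDual_nonpos_pos_of_notMem_closure_hull
    (hne.preimage (add_left_surjective p)) fun h =>
      hasym (mem_asymptoticCone_of_mem_closure_of_ray_disjoint hC (closure_mono hsub h) hray)
  refine ⟨f, fun q hq => ?_, hfv⟩
  simpa using hf (q - p) (by simpa using hq)

end Cones

section KuratowskiLimsup

variable {U V : Type*} [TopologicalSpace V] {l : Filter U} {M : U → Set V}

theorem subset_kuratowskiLimsup_of_pure_le {u : U} (hu : pure u ≤ l) :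
    M u ⊆ kuratowskiLimsup l M :=
  fun _ hv _ hW _ hZ => ⟨u, hu hZ, _, hv, mem_of_mem_nhds hW⟩

theorem kuratowskiLimsup_subset_of_isClosed {C : Set V} (hC : IsClosed C)
    (hM : ∀ᶠ u in l, M u ⊆ C) : kuratowskiLimsup l M ⊆ C := fun v hv => by
  refine hC.closure_subset (mem_closure_iff_nhds.2 fun W hW => ?_)
  obtain ⟨u, hu, z, hz, hzW⟩ := hv W hW _ hM
  exact ⟨z, hzW, hu hz⟩

theorem isClosed_kuratowskiLimsup : IsClosed (kuratowskiLimsup l M) := by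
  refine isClosed_of_closure_subset fun v hv W hW Z hZ => ?_
  obtain ⟨O, hOW, hO, hvO⟩ := mem_nhds_iff.1 hW
  obtain ⟨w, hwO, hw⟩ := mem_closure_iff.1 hv O hO hvO
  obtain ⟨u, hu, h⟩ := hw O (hO.mem_nhds hwO) Z hZ
  exact ⟨u, hu, h.mono (Set.inter_subset_inter_right _ hOW)⟩

end KuratowskiLimsup

section Pairing

variable {X Y : Type*} [AddCommGroup X] [Module ℝ X] [AddCommGroup Y] [Module ℝ Y]
  {B : X →ₗ[ℝ] Y →ₗ[ℝ] ℝ}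

theorem mem_normalCone_image_add_iff {T : Set X} {x : X} {y : Y} :
    y ∈ normalCone B ((fun v => x + v) '' T) x ↔ ∀ v ∈ T, B v y ≤ 0 := by
  simp only [normalCone, Set.mem_ofPred_eq, Set.forall_mem_image, add_sub_cancel_left]

theorem normalCone_union (S T : Set X) (x : X) :
    normalCone B (S ∪ T) x = normalCone B S x ∩ normalCone B T x := by
  ext y
  simp only [normalCone, Set.mem_union, or_imp, forall_and, Set.mem_inter_iff, Set.mem_ofPred_eq]

theorem smul_mem_normalCone {S : Set X} {x : X} {y : Y} (hy : y ∈ normalCone B S x) {t : ℝ}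
    (ht : 0 ≤ t) : t • y ∈ normalCone B S x := fun z hz => by
  rw [map_smul, smul_eq_mul]
  exact mul_nonpos_of_nonneg_of_nonpos ht (hy z hz)

theorem isClosed_normalCone [TopologicalSpace Y] (hB : ∀ x, Continuous (B x)) (S : Set X) (x : X) :
    IsClosed (normalCone B S x) := by
  have hInter : normalCone B S x = ⋂ z ∈ S, {y | B (z - x) y ≤ 0} := by
    ext y
    simp [normalCone]
  rw [hInter]
  exact isClosed_biInter fun z _ => isClosed_le (hB (z - x)) continuous_const

theorem closure_Ici_smul_subset_normalCone [TopologicalSpace Y] (hB : ∀ x, Continuous (B x))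
    {A : Set Y} {S : Set X} {x : X} (hA : A ⊆ normalCone B S x) :
    closure (Set.Ici (0 : ℝ) • A) ⊆ normalCone B S x :=
  closure_minimal (Set.smul_subset_iff.2 fun _ ht _ ha => smul_mem_normalCone (hA ha) ht)
    (isClosed_normalCone hB S x)

end Pairing

section Subdifferential

variable {X Y : Type*} [AddCommGroup X] [Module ℝ X] [AddCommGroup Y] [Module ℝ Y]
  {B : X →ₗ[ℝ] Y →ₗ[ℝ] ℝ} {Φ : X → EReal} {x : X} {c ε : ℝ} {y : Y}

/-- The epigraph of `Φ`. Its heights are real, so that it lives in the real vector space `X × ℝ` and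
can be separated from points by Hahn–Banach. -/
def realEpigraph (Φ : X → EReal) : Set (X × ℝ) := {p | Φ p.1 ≤ (p.2 : EReal)}

theorem mem_epsSubdifferential_iff (hbot : ∀ u, Φ u ≠ ⊥) (hc : Φ x = c) :
    y ∈ epsSubdifferential B Φ ε x ↔
      0 ≤ ε ∧ ∀ p ∈ realEpigraph Φ, B (p.1 - x) y ≤ p.2 - (c - ε) := by
  have hdom : x ∈ effectiveDomain Φ := hc.trans_lt (EReal.coe_lt_top c)
  simp only [epsSubdifferential, Set.mem_ofPred_eq, hdom, true_and, hc]
  refine and_congr_right fun _ => ⟨fun h p hp => ?_, fun h u => ?_⟩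
  · have hle : ((B (p.1 - x) y : ℝ) : EReal) ≤ (p.2 : EReal) - c + ε :=
      (h p.1).trans (add_le_add_left (EReal.sub_le_sub hp le_rfl) _)
    rw [← sub_add]
    exact_mod_cast hle
  · induction hu : Φ u with
    | bot => exact absurd hu (hbot u)
    | top => simp
    | coe r =>
      have hle := h (u, r) hu.le
      rw [← sub_add] at hle
      exact_mod_cast hle

theorem inv_smul_mem_epsSubdifferential (hbot : ∀ u, Φ u ≠ ⊥) (hc : Φ x = c) (hε : 0 ≤ ε) {β : ℝ}
    (hβ : 0 < β) (hy : ∀ p ∈ realEpigraph Φ, B (p.1 - x) y ≤ β * (p.2 - (c - ε))) :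
    β⁻¹ • y ∈ epsSubdifferential B Φ ε x := by
  refine (mem_epsSubdifferential_iff hbot hc).2 ⟨hε, fun p hp => ?_⟩
  rw [map_smul, smul_eq_mul, inv_mul_le_iff₀ hβ]
  exact hy p hp

theorem convex_epsSubdifferential (hbot : ∀ u, Φ u ≠ ⊥) (hc : Φ x = c) :
    Convex ℝ (epsSubdifferential B Φ ε x) := by
  intro y hy z hz a b ha hb hab
  simp only [mem_epsSubdifferential_iff hbot hc] at hy hz ⊢
  refine ⟨hy.1, fun p hp => ?_⟩
  exact convex_halfSpace_le (B (p.1 - x)).isLinear _ (hy.2 p hp) (hz.2 p hp) ha hb hab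

theorem epsSubdifferential_subset_normalCone_sublevelSet (hbot : ∀ u, Φ u ≠ ⊥) (hc : Φ x = c) :
    epsSubdifferential B Φ ε x ⊆ normalCone B (sublevelSet Φ ((c - ε : ℝ) : EReal)) x :=
  fun y hy z hz => by
    simpa using ((mem_epsSubdifferential_iff hbot hc).1 hy).2 (z, c - ε) hz

theorem epsSubdifferential_subset_normalCone_asymptoticConeOf (hbot : ∀ u, Φ u ≠ ⊥)
    (hc : Φ x = c) :
    epsSubdifferential B Φ ε x ⊆
      normalCone B ((fun v => x + v) '' asymptoticConeOf (sublevelSet Φ c)) x := fun y hy => by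
  obtain ⟨hε, hy⟩ := (mem_epsSubdifferential_iff hbot hc).1 hy
  refine mem_normalCone_image_add_iff.2 fun v hv => ?_
  have hbound : ∀ t : ℝ, 0 ≤ t → t * B v y ≤ ε := fun t ht => by
    simpa using hy (x + t • v, c) (hv x hc.le t ht)
  by_contra! hpos
  have hlarge := hbound ((ε + 1) / B v y) (by positivity)
  rw [div_mul_cancel₀ _ hpos.ne'] at hlarge
  linarith

end Subdifferential

section DualPair

variable {X Y : Type*} [AddCommGroup X] [Module ℝ X] [TopologicalSpace X]
  [AddCommGroup Y] [Module ℝ Y] [TopologicalSpace Y]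
  {B : X →ₗ[ℝ] Y →ₗ[ℝ] ℝ} {Φ : X → EReal} {x v : X} {c ε : ℝ}

theorem IsCompatibleDualPair.continuous_right (hB : IsCompatibleDualPair B) (x : X) :
    Continuous (B x) :=
  (hB.continuous_iff_right (B x)).2 ⟨x, fun _ => rfl⟩

theorem IsCompatibleDualPair.exists_strongDual_prod_eq (hB : IsCompatibleDualPair B)
    (f : StrongDual ℝ (X × ℝ)) : ∃ (y : Y) (β : ℝ), ∀ p, f p = B p.1 y - β * p.2 := by
  obtain ⟨y, hy⟩ := (hB.continuous_iff_left (f.comp (.inl ℝ X ℝ)).toLinearMap).1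
    (f.comp (.inl ℝ X ℝ)).continuous
  refine ⟨y, -f (0, 1), fun p => ?_⟩
  calc f p = f (p.1, 0) + f (p.2 • (0, 1)) := by rw [← map_add]; simp
    _ = B p.1 y - -f (0, 1) * p.2 := by
      rw [map_smul, smul_eq_mul, ← hy p.1]
      simp [mul_comm]

theorem IsGammaZero.isClosed_realEpigraph (hΦ : IsGammaZero Φ) : IsClosed (realEpigraph Φ) :=
  hΦ.lsc.isClosed_epigraph.preimage
    (continuous_fst.prodMk (continuous_coe_real_ereal.comp continuous_snd))

theorem IsGammaZero.nonempty_realEpigraph (hΦ : IsGammaZero Φ) : (realEpigraph Φ).Nonempty :=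
  hΦ.proper.elim fun z hz => ⟨(z, (Φ z).toReal), EReal.le_coe_toReal hz.ne⟩

variable [IsTopologicalAddGroup X] [ContinuousSMul ℝ X]

theorem IsGammaZero.add_smul_mem_realEpigraph (hΦ : IsGammaZero Φ) {p w : X × ℝ}
    (hw : w ∈ asymptoticCone ℝ (realEpigraph Φ)) (hp : p ∈ realEpigraph Φ) {t : ℝ} (ht : 0 ≤ t) :
    p + t • w ∈ realEpigraph Φ := by
  rw [add_comm]
  exact Convex.smul_vadd_mem_of_isClosed_of_mem_asymptoticCone hΦ.convex hΦ.isClosed_realEpigraph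
    ht hw hp

theorem IsGammaZero.mem_asymptoticConeOf_sublevelSet (hΦ : IsGammaZero Φ)
    (hv : (v, (0 : ℝ)) ∈ asymptoticCone ℝ (realEpigraph Φ)) (a : ℝ) :
    v ∈ asymptoticConeOf (sublevelSet Φ a) := fun z hz t ht => by
  simpa [realEpigraph, sublevelSet] using hΦ.add_smul_mem_realEpigraph (p := (z, a)) hv hz ht

variable [LocallyConvexSpace ℝ X]

theorem IsGammaZero.exists_apply_sub_le_and_lt_apply (hΦ : IsGammaZero Φ)
    (hB : IsCompatibleDualPair B) {a : ℝ} {w : X × ℝ}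
    (hray : ∀ t : ℝ, 0 ≤ t → (x, a) + t • w ∉ realEpigraph Φ)
    (hasym : w ∉ asymptoticCone ℝ (realEpigraph Φ)) :
    ∃ (y : Y) (β : ℝ), (∀ p ∈ realEpigraph Φ, B (p.1 - x) y ≤ β * (p.2 - a)) ∧
      β * w.2 < B w.1 y := by
  obtain ⟨f, hf, hfw⟩ := exists_strongDual_le_apply_and_pos_of_ray_disjoint hΦ.convex
    hΦ.isClosed_realEpigraph hΦ.nonempty_realEpigraph hray hasym
  obtain ⟨y, β, hyβ⟩ := hB.exists_strongDual_prod_eq f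
  simp only [hyβ, sub_pos] at hf hfw
  refine ⟨y, β, fun p hp => ?_, hfw⟩
  rw [map_sub, LinearMap.sub_apply]
  linarith [hf p hp]

theorem IsGammaZero.nonempty_epsSubdifferential (hΦ : IsGammaZero Φ)
    (hB : IsCompatibleDualPair B) (hc : Φ x = c) (hε : 0 < ε) :
    (epsSubdifferential B Φ ε x).Nonempty := by
  have hbelow : ∀ r : ℝ, r < c → (x, r) ∉ realEpigraph Φ := fun r hr h =>
    hr.not_ge (EReal.coe_le_coe_iff.1 (hc.symm.trans_le h))
  obtain ⟨y, β, hy, hβ⟩ := hΦ.exists_apply_sub_le_and_lt_apply hB (x := x) (a := c - ε)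
    (w := (0, -1)) (fun t ht => by simpa using hbelow (c - ε + -t) (by linarith))
    (fun h => hbelow (c - 1) (by linarith) (by
      simpa [sub_eq_add_neg] using
        hΦ.add_smul_mem_realEpigraph (p := (x, c)) h hc.le zero_le_one))
  exact ⟨_, inv_smul_mem_epsSubdifferential hΦ.ne_bot hc hε.le (by simpa using hβ) hy⟩

theorem IsGammaZero.exists_mem_epsSubdifferential_pos (hΦ : IsGammaZero Φ)
    (hB : IsCompatibleDualPair B) (hc : Φ x = c) (hε : 0 < ε)
    (hray : ∀ t : ℝ, 0 ≤ t → x + t • v ∉ sublevelSet Φ ((c - ε : ℝ) : EReal))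
    (hasym : v ∉ asymptoticConeOf (sublevelSet Φ c)) :
    ∃ y ∈ epsSubdifferential B Φ ε x, 0 < B v y := by
  obtain ⟨y, β, hy, hvy⟩ := hΦ.exists_apply_sub_le_and_lt_apply hB (x := x) (a := c - ε)
    (w := (v, 0)) (fun t ht => by simpa [realEpigraph, sublevelSet] using hray t ht)
    fun h => hasym (hΦ.mem_asymptoticConeOf_sublevelSet h c)
  have hvy : 0 < B v y := by simpa using hvy
  have hβ : 0 ≤ β := by
    have hxc := hy (x, c) hc.le
    simp only [sub_self, map_zero, LinearMap.zero_apply, sub_sub_cancel] at hxc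
    exact nonneg_of_mul_nonneg_left hxc hε
  obtain ⟨z, hz⟩ := hΦ.nonempty_epsSubdifferential hB hc hε
  have hz := ((mem_epsSubdifferential_iff hΦ.ne_bot hc).1 hz).2
  -- The separating functional `(y, β)` is vertical if `β = 0`; adding `δ • (z, 1)` tilts it.
  obtain ⟨δ, hδ, hvδ⟩ : ∃ δ : ℝ, 0 < δ ∧ 0 < B v (y + δ • z) := by
    refine ⟨B v y / (|B v z| + 1), by positivity, ?_⟩
    have habs : B v y / (|B v z| + 1) * |B v z| < B v y := by
      rw [div_mul_eq_mul_div, div_lt_iff₀ (by positivity)]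
      linarith
    rw [map_add, map_smul, smul_eq_mul]
    have hle := mul_le_mul_of_nonneg_left (neg_abs_le (B v z))
      (by positivity : 0 ≤ B v y / (|B v z| + 1))
    linarith
  refine ⟨(β + δ)⁻¹ • (y + δ • z), inv_smul_mem_epsSubdifferential hΦ.ne_bot hc hε.le
    (by positivity) fun p hp => ?_, ?_⟩
  · rw [map_add, map_smul, smul_eq_mul, add_mul]
    exact add_le_add (hy p hp) (mul_le_mul_of_nonneg_left (hz p hp) hδ.le)
  · rw [map_smul, smul_eq_mul]
    positivity

variable [IsTopologicalAddGroup Y] [ContinuousSMul ℝ Y] [LocallyConvexSpace ℝ Y]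

theorem IsGammaZero.normalCone_union_eq_closure (hΦ : IsGammaZero Φ)
    (hB : IsCompatibleDualPair B) (hc : Φ x = c) (hε : 0 < ε) :
    normalCone B (sublevelSet Φ ((c - ε : ℝ) : EReal) ∪
        (fun v => x + v) '' asymptoticConeOf (sublevelSet Φ c)) x =
      closure (Set.Ici (0 : ℝ) • epsSubdifferential B Φ ε x) := by
  rw [normalCone_union]
  refine Set.Subset.antisymm (fun y hy => ?_) (Set.subset_inter
    (closure_Ici_smul_subset_normalCone hB.continuous_right
      (epsSubdifferential_subset_normalCone_sublevelSet hΦ.ne_bot hc))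
    (closure_Ici_smul_subset_normalCone hB.continuous_right
      (epsSubdifferential_subset_normalCone_asymptoticConeOf hΦ.ne_bot hc)))
  obtain ⟨hsub, hasym⟩ := hy
  refine mem_closure_Ici_smul_of_forall_strongDual (convex_epsSubdifferential hΦ.ne_bot hc)
    (hΦ.nonempty_epsSubdifferential hB hc hε) fun f hf => ?_
  obtain ⟨v, hv⟩ := (hB.continuous_iff_right f.toLinearMap).1 f.continuous
  replace hv : ∀ z, f z = B v z := hv
  simp only [hv] at hf ⊢
  by_contra! hpos
  have hray : ∀ t : ℝ, 0 ≤ t → x + t • v ∉ sublevelSet Φ ((c - ε : ℝ) : EReal) := by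
    intro t ht hmem
    have hle : t * B v y ≤ 0 := by simpa using hsub _ hmem
    obtain rfl : t = 0 := le_antisymm (nonpos_of_mul_nonpos_left hle hpos) ht
    rw [zero_smul, add_zero, sublevelSet, Set.mem_ofPred_eq, hc, EReal.coe_le_coe_iff] at hmem
    linarith
  obtain ⟨z, hz, hvz⟩ := hΦ.exists_mem_epsSubdifferential_pos hB hc hε hray
    fun h => (mem_normalCone_image_add_iff.1 hasym v h).not_gt hpos
  exact (hf z hz).not_gt hvz

theorem IsGammaZero.normalCone_eq_closure_of_sublevelSet_eq_empty (hΦ : IsGammaZero Φ)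
    (hB : IsCompatibleDualPair B) (hc : Φ x = c) {a : ℝ} (ha : sublevelSet Φ a = ∅)
    (hε : c - a ≤ ε) :
    normalCone B ((fun v => x + v) '' asymptoticConeOf (sublevelSet Φ c)) x =
      closure (Set.Ici (0 : ℝ) • epsSubdifferential B Φ ε x) := by
  have hac : a < c := by
    by_contra! h
    exact Set.eq_empty_iff_forall_notMem.1 ha x (hc.trans_le (EReal.coe_le_coe_iff.2 h))
  have hempty : sublevelSet Φ ((c - ε : ℝ) : EReal) = ∅ :=
    Set.subset_eq_empty (fun z hz => le_trans hz (EReal.coe_le_coe_iff.2 (by linarith))) ha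
  simpa only [hempty, Set.empty_union] using
    hΦ.normalCone_union_eq_closure hB hc ((sub_pos.2 hac).trans_le hε)

theorem IsGammaZero.normalCone_eq_kuratowskiLimsup_of_sublevelSet_eq_empty (hΦ : IsGammaZero Φ)
    (hB : IsCompatibleDualPair B) (hc : Φ x = c) {a : ℝ} (ha : sublevelSet Φ a = ∅) :
    normalCone B ((fun v => x + v) '' asymptoticConeOf (sublevelSet Φ c)) x =
      kuratowskiLimsup
        (Filter.comap (fun p : ℝ × ℝ => p.1 * (a - c + p.2)) (𝓝 0) ⊓
          Filter.principal {p : ℝ × ℝ | 0 ≤ p.1})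
        (fun p : ℝ × ℝ => p.1 • epsSubdifferential B Φ p.2 x) := by
  refine Set.Subset.antisymm ?_ (kuratowskiLimsup_subset_of_isClosed
    (isClosed_normalCone hB.continuous_right _ x) (Filter.mem_inf_of_right fun p hp => ?_))
  · rw [hΦ.normalCone_eq_closure_of_sublevelSet_eq_empty hB hc ha le_rfl]
    refine closure_minimal (Set.smul_subset_iff.2 fun μ hμ y hy => ?_) isClosed_kuratowskiLimsup
    have hpure : pure (μ, c - a) ≤ Filter.comap (fun p : ℝ × ℝ => p.1 * (a - c + p.2)) (𝓝 0) := by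
      rw [← Filter.map_le_iff_le_comap, Filter.map_pure]
      simp
    exact subset_kuratowskiLimsup_of_pure_le (le_inf hpure ((Filter.pure_le_principal _).2 hμ))
      (Set.smul_mem_smul_set hy)
  · rintro _ ⟨y, hy, rfl⟩
    exact smul_mem_normalCone
      (epsSubdifferential_subset_normalCone_asymptoticConeOf hΦ.ne_bot hc hy) hp

end DualPair

theorem corollary3p5 {X Y : Type*}
    [AddCommGroup X] [Module ℝ X] [TopologicalSpace X] [IsTopologicalAddGroup X]
    [ContinuousSMul ℝ X] [LocallyConvexSpace ℝ X]
    [AddCommGroup Y] [Module ℝ Y] [TopologicalSpace Y] [IsTopologicalAddGroup Y]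
    [ContinuousSMul ℝ Y] [LocallyConvexSpace ℝ Y]
    (B : X →ₗ[ℝ] Y →ₗ[ℝ] ℝ) (hB : IsCompatibleDualPair B)
    (Φ : X → EReal) (hΦ : IsGammaZero Φ)
    (xbar : X) (hxbar : xbar ∈ effectiveDomain Φ) (lam : ℝ) :
    ((sublevelSet Φ lam).Nonempty → (lam : EReal) < Φ xbar →
      normalCone B
          (sublevelSet Φ lam ∪
            (fun v => xbar + v) '' asymptoticConeOf (sublevelSet Φ (Φ xbar))) xbar =
        closure (Set.Ici (0 : ℝ) • epsSubdifferential B Φ ((Φ xbar).toReal - lam) xbar)) ∧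
    (sublevelSet Φ lam = ∅ →
      normalCone B
          ((fun v => xbar + v) '' asymptoticConeOf (sublevelSet Φ (Φ xbar))) xbar =
        kuratowskiLimsup
          (Filter.comap (fun p : ℝ × ℝ => p.1 * (lam - (Φ xbar).toReal + p.2)) (𝓝 0) ⊓
            Filter.principal {p : ℝ × ℝ | 0 ≤ p.1})
          (fun p : ℝ × ℝ => p.1 • epsSubdifferential B Φ p.2 xbar) ∧
      ∀ ε : ℝ, (Φ xbar).toReal - lam ≤ ε →
        normalCone B
            ((fun v => xbar + v) '' asymptoticConeOf (sublevelSet Φ (Φ xbar))) xbar =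
          closure (Set.Ici (0 : ℝ) • epsSubdifferential B Φ ε xbar)) := by
  obtain ⟨c, hc⟩ : ∃ c : ℝ, Φ xbar = c :=
    ⟨_, (EReal.coe_toReal hxbar.ne (hΦ.ne_bot xbar)).symm⟩
  simp only [hc, EReal.toReal_coe, EReal.coe_lt_coe_iff]
  refine ⟨fun _ hlam => ?_, fun hempty => ⟨?_, fun ε hε => ?_⟩⟩
  · have h := hΦ.normalCone_union_eq_closure hB hc (sub_pos.2 hlam)
    rwa [sub_sub_cancel] at h
  · exact hΦ.normalCone_eq_kuratowskiLimsup_of_sublevelSet_eq_empty hB hc hempty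
  · exact hΦ.normalCone_eq_closure_of_sublevelSet_eq_empty hB hc hempty hε
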